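/- Let $d\ge 1$. Let $S^d\subset\mathbb R^{d+1}$ be the unit sphere, let $\chi\in[0,\pi]$ be the angle of a point of $S^d$ from the north pole, and equip $\mathbb R\times S^d$ (time coordinate $T$, time orientation by increasing $T$) with the Lorentzian metric $dT^2-d\omega_d^2=dT^2-d\chi^2-\sin^2\chi\,d\omega_{d-1}^2$. Compactified $(d+1)$-dimensional Minkowski space is $\tilde M=\{|T|\le\pi-\chi\}\subset\mathbb R\times S^d$. Minkowski space $M=\mathbb M^{(1,d)}$ is embedded in it by $t-r=\tan P$, $t+r=\tan Q$, $T=Q+P$, $\chi=Q-P$ (angular variables unchanged). Let $\mathcal I^\pm=\{T=\pm(\pi-\chi),\ 0<\chi<\pi\}$ and let $i^0$ be the point $T=0$, $\chi=\pi$. All curves below are curves in $\tilde M$. Let $I^+(a)$ (respectively $J^+(a)$) be the set of points of $\tilde M$ that are reached from $a$ by a smooth future-directed timelike (respectively causal) curve, where $a\in J^+(a)$ by convention, and let $J^-(a)=\{b\in\tilde M: a\in J^+(b)\}$. Let $p\in\mathcal I^-$. Then there is a unique point $q\in\mathcal I^+$ that is connected to $p$ by a future-directed null geodesic from $p$ which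 enters $M$; a future-directed null geodesic from $p$ to a point of $\mathcal I^+$ enters $M$ if and only if it does not pass through $i^0$. Moreover $q\in\partial J^+(p)$ (boundary in $\tilde M$), and $$I^+(p)\cap\mathcal I^+=\mathcal I^+\setminus\bigl(J^-(q)\cap\mathcal I^+\bigr).$$ The points of $\mathcal I^+$ that cannot be connected to $p$ by a smooth timelike curve are exactly $q$ itself and the points of $\mathcal I^+$ that can be reached from $q$ by a past-directed null geodesic; equivalently, they are exactly the points of the segment with future endpoint $q$ (included) of the null generator of $\mathcal I^+$ through $q$, that is, $q$ and the points reached from $q$ by a past-directed null geodesic contained in $\mathcal I^+$. -/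

import Mathlib

noncomputable section

open Set Real
open scoped ContDiff

/-- Ambient space `ℝ × ℝ^{d+1}` of the Einstein cylinder `ℝ × S^d`. A point `x` has time coordinate
`T = x.1` and position `x.2`, which lies on the unit sphere `S^d` for points of the cylinder. -/
abbrev Ambient (d : ℕ) : Type := ℝ × EuclideanSpace ℝ (Fin (d + 1))

/-- The radial coordinate `χ ∈ [0, π]`: the angle between the position and the north pole
`(1, 0, …, 0)` of `S^d`. -/
def polarAngle {d : ℕ} (x : Ambient d) : ℝ := arccos (x.2 0)

/-- The quadratic form of `dT² - dω_d²`, where `dω_d² = dχ² + sin² χ dω_{d-1}²` is the round metric,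
i.e. the one that `S^d` inherits from `ℝ^{d+1}`; evaluated on a tangent vector of the cylinder. -/
def lineElement {d : ℕ} (v : Ambient d) : ℝ := v.1 ^ 2 - ‖v.2‖ ^ 2

/-- The conformal embedding of Minkowski space into the cylinder: with `r = ‖x‖`,
`t - r = tan P`, `t + r = tan Q`, `T = Q + P`, `χ = Q - P`, the event `(t, x)` goes to time `T` and
to the point `(cos χ, sin χ · x / r)` of `S^d` (the north pole if `x = 0`). -/
def minkowskiEmbedding (d : ℕ) (z : ℝ × EuclideanSpace ℝ (Fin d)) : Ambient d :=
  (arctan (z.1 + ‖z.2‖) + arctan (z.1 - ‖z.2‖),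
    WithLp.toLp 2 (Fin.cons (cos (arctan (z.1 + ‖z.2‖) - arctan (z.1 - ‖z.2‖)))
      (fun i => sin (arctan (z.1 + ‖z.2‖) - arctan (z.1 - ‖z.2‖)) * (z.2 i / ‖z.2‖))))

/-- The physical spacetime `M`: Minkowski space `𝕄^{(1,d)}` inside its compactification. -/
def physicalSpacetime (d : ℕ) : Set (Ambient d) := Set.range (minkowskiEmbedding d)

/-- The compactified spacetime `M̃ = {|T| ≤ π - χ}`. -/
def compactifiedMinkowski (d : ℕ) : Set (Ambient d) :=
  {x | ‖x.2‖ = 1 ∧ |x.1| ≤ π - polarAngle x}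

/-- Future null infinity `𝓘⁺`. -/
def scriPlus (d : ℕ) : Set (Ambient d) :=
  {x | ‖x.2‖ = 1 ∧ 0 < polarAngle x ∧ polarAngle x < π ∧ x.1 = π - polarAngle x}

/-- Past null infinity `𝓘⁻`. -/
def scriMinus (d : ℕ) : Set (Ambient d) :=
  {x | ‖x.2‖ = 1 ∧ 0 < polarAngle x ∧ polarAngle x < π ∧ x.1 = -(π - polarAngle x)}

/-- Spatial infinity `i⁰`: time `0` at the south pole (`χ = π`). -/
def spatialInfinity (d : ℕ) : Ambient d := (0, -EuclideanSpace.single 0 1)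

/-- Velocity of a curve with parameter interval `[0, 1]` (one-sided at the endpoints). -/
def velocity {d : ℕ} (γ : ℝ → Ambient d) (s : ℝ) : Ambient d := derivWithin γ (Icc 0 1) s

/-- Second derivative, in the ambient space, of a curve with parameter interval `[0, 1]`. -/
def acceleration {d : ℕ} (γ : ℝ → Ambient d) (s : ℝ) : Ambient d :=
  derivWithin (velocity γ) (Icc 0 1) s

/-- `γ` restricts to a smooth curve `[0, 1] → M̃` from `a` to `b`. -/
structure IsSmoothCurve {d : ℕ} (γ : ℝ → Ambient d) (a b : Ambient d) : Prop where
  smooth : ContDiffOn ℝ ∞ γ (Icc 0 1)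
  mem : ∀ s ∈ Icc (0 : ℝ) 1, γ s ∈ compactifiedMinkowski d
  source : γ 0 = a
  target : γ 1 = b

/-- The curve is timelike (of either time direction). -/
def IsTimelike {d : ℕ} (γ : ℝ → Ambient d) : Prop :=
  ∀ s ∈ Icc (0 : ℝ) 1, 0 < lineElement (velocity γ s)

/-- The curve is causal: its velocity is nonzero and timelike or null. -/
def IsCausal {d : ℕ} (γ : ℝ → Ambient d) : Prop :=
  ∀ s ∈ Icc (0 : ℝ) 1, velocity γ s ≠ 0 ∧ 0 ≤ lineElement (velocity γ s)

/-- The curve is null: its velocity is nonzero and null. -/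
def IsNull {d : ℕ} (γ : ℝ → Ambient d) : Prop :=
  ∀ s ∈ Icc (0 : ℝ) 1, velocity γ s ≠ 0 ∧ lineElement (velocity γ s) = 0

/-- The curve is future directed. -/
def IsFutureDirected {d : ℕ} (γ : ℝ → Ambient d) : Prop :=
  ∀ s ∈ Icc (0 : ℝ) 1, 0 < (velocity γ s).1

/-- Affinely parametrized geodesics of the product `ℝ × S^d`: `T'' = 0` and `ω'' = -‖ω'‖² ω`. -/
def IsGeodesic {d : ℕ} (γ : ℝ → Ambient d) : Prop :=
  ∀ s ∈ Icc (0 : ℝ) 1, acceleration γ s = (0, -(‖(velocity γ s).2‖ ^ 2) • (γ s).2)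

/-- `γ` is a future directed null geodesic in `M̃` from `a` to `b`. Run backwards, it is a past
directed null geodesic from `b` to `a`. -/
structure IsFutureNullGeodesic {d : ℕ} (γ : ℝ → Ambient d) (a b : Ambient d) : Prop
    extends IsSmoothCurve γ a b where
  geodesic : IsGeodesic γ
  null : IsNull γ
  future : IsFutureDirected γ

/-- The curve enters the physical spacetime `M`. -/
def EntersPhysical {d : ℕ} (γ : ℝ → Ambient d) : Prop :=
  ∃ s ∈ Icc (0 : ℝ) 1, γ s ∈ physicalSpacetime d

/-- `a` and `b` are connected by a smooth timelike curve in `M̃`. -/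
def TimelikeConnected {d : ℕ} (a b : Ambient d) : Prop :=
  ∃ γ : ℝ → Ambient d, IsSmoothCurve γ a b ∧ IsTimelike γ

/-- `I⁺(p) ⊆ M̃`. -/
def chronologicalFuture {d : ℕ} (p : Ambient d) : Set (Ambient d) :=
  {q | q ∈ compactifiedMinkowski d ∧
    ∃ γ : ℝ → Ambient d, IsSmoothCurve γ p q ∧ IsTimelike γ ∧ IsFutureDirected γ}

/-- `J⁺(p) ⊆ M̃`; as usual `p` itself (the trivial curve) is included. -/
def causalFuture {d : ℕ} (p : Ambient d) : Set (Ambient d) :=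
  {q | q ∈ compactifiedMinkowski d ∧ (q = p ∨
    ∃ γ : ℝ → Ambient d, IsSmoothCurve γ p q ∧ IsCausal γ ∧ IsFutureDirected γ)}

/-- `J⁻(p) ⊆ M̃`. -/
def causalPast {d : ℕ} (p : Ambient d) : Set (Ambient d) :=
  {q | q ∈ compactifiedMinkowski d ∧ p ∈ causalFuture q}

/-- The topological boundary of `A ⊆ M̃` in the space `M̃`. -/
def boundaryInCompactified {d : ℕ} (A : Set (Ambient d)) : Set (Ambient d) :=
  Subtype.val '' frontier (Subtype.val ⁻¹' A : Set (compactifiedMinkowski d))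

/-- The segment that ends at `q` of the null generator of `𝓘⁺` through `q`: the point `q` and the
points from which a future directed null geodesic that stays in `𝓘⁺` leads to `q`. -/
def pastGeneratorSegment {d : ℕ} (q : Ambient d) : Set (Ambient d) :=
  {r | r = q ∨ ∃ γ : ℝ → Ambient d, IsFutureNullGeodesic γ r q ∧
    ∀ s ∈ Icc (0 : ℝ) 1, γ s ∈ scriPlus d}

/-- In the coordinates of the cylinder, Minkowski space is `{|T| < π - χ}`. -/
theorem physicalSpacetime_eq (d : ℕ) :
    physicalSpacetime d = {x : Ambient d | ‖x.2‖ = 1 ∧ |x.1| < π - polarAngle x} := by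
  ext x
  constructor
  · rintro ⟨⟨t, y⟩, rfl⟩
    have hr : 0 ≤ ‖y‖ := norm_nonneg y
    have h1 : arctan (t - ‖y‖) ≤ arctan (t + ‖y‖) := arctan_mono (by linarith)
    have h2 := arctan_lt_pi_div_two (t + ‖y‖)
    have h3 := neg_pi_div_two_lt_arctan (t - ‖y‖)
    refine ⟨?_, ?_⟩
    · have : ‖(minkowskiEmbedding d (t, y)).2‖ ^ 2 = 1 := by
        simp only [minkowskiEmbedding, EuclideanSpace.norm_sq_eq, Fin.sum_univ_succ,
          Fin.cons_zero, Fin.cons_succ, Real.norm_eq_abs, sq_abs]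
        simp only [mul_pow, div_pow, ← Finset.mul_sum, ← Finset.sum_div]
        have hy : ∑ i, y i ^ 2 = ‖y‖ ^ 2 := by
          simp [EuclideanSpace.norm_sq_eq]
        rw [hy]
        rcases eq_or_ne y 0 with rfl | h
        · simp
        · rw [div_self (by simpa using h), mul_one, cos_sq_add_sin_sq]
      nlinarith [norm_nonneg (minkowskiEmbedding d (t, y)).2]
    · simp only [minkowskiEmbedding, polarAngle, Fin.cons_zero]
      rw [arccos_cos (by linarith) (by linarith), abs_lt]
      constructor <;> linarith
  · rintro ⟨hn, hT⟩
    obtain ⟨T, w⟩ := x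
    simp only [polarAngle] at hn hT
    have hsum : w 0 ^ 2 + ∑ i : Fin d, w i.succ ^ 2 = 1 := by
      have := EuclideanSpace.norm_sq_eq w
      rw [hn, Fin.sum_univ_succ] at this
      simpa using this.symm
    have hs0 : 0 ≤ ∑ i : Fin d, w i.succ ^ 2 := Finset.sum_nonneg fun i _ => sq_nonneg _
    have hw1 : w 0 ≤ 1 := by nlinarith
    have hw2 : -1 ≤ w 0 := by nlinarith
    set χ := arccos (w 0) with hχ
    have hcos : cos χ = w 0 := cos_arccos hw2 hw1
    have hχ0 : 0 ≤ χ := arccos_nonneg _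
    obtain ⟨hT1, hT2⟩ := abs_lt.1 hT
    have hχπ : χ < π := by linarith
    have hsinsq : ∑ i : Fin d, w i.succ ^ 2 = sin χ ^ 2 := by
      have := sin_sq_add_cos_sq χ
      rw [hcos] at this
      linarith
    have hP : arctan (tan ((T - χ) / 2)) = (T - χ) / 2 := arctan_tan (by linarith) (by linarith)
    have hQ : arctan (tan ((T + χ) / 2)) = (T + χ) / 2 := arctan_tan (by linarith) (by linarith)
    set u := tan ((T - χ) / 2) with hu
    set v := tan ((T + χ) / 2) with hv
    have huv : u ≤ v := by
      have : arctan u ≤ arctan v := by rw [hP, hQ]; linarith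
      exact arctan_strictMono.le_iff_le.1 this
    rcases hχ0.eq_or_lt with h0 | hpos
    · have hz : ∀ i : Fin d, w i.succ = 0 := by
        intro i
        have : ∑ i : Fin d, w i.succ ^ 2 = 0 := by rw [hsinsq, ← h0]; simp
        have := (Finset.sum_eq_zero_iff_of_nonneg (fun i _ => sq_nonneg _)).1 this i
          (Finset.mem_univ i)
        exact pow_eq_zero_iff (two_ne_zero) |>.1 this
      have huv' : u = v := by rw [hu, hv, ← h0]; simp
      refine ⟨(u, 0), ?_⟩
      simp only [minkowskiEmbedding, norm_zero, add_zero, sub_zero, sub_self]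
      refine Prod.ext ?_ ?_
      · simp only [hP]; linarith
      · ext i
        refine Fin.cases ?_ (fun j => ?_) i
        · simp [← hcos, ← h0]
        · simp [hz]
    · have hsin : 0 < sin χ := sin_pos_of_pos_of_lt_pi hpos hχπ
      have huv' : u < v := by
        have : arctan u < arctan v := by rw [hP, hQ]; linarith
        exact arctan_strictMono.lt_iff_lt.1 this
      set r := (v - u) / 2 with hr
      have hrpos : 0 < r := by rw [hr]; linarith
      set y : EuclideanSpace ℝ (Fin d) := WithLp.toLp 2 (fun i => r / sin χ * w i.succ) with hy
      have hyn : ‖y‖ = r := by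
        have : ‖y‖ ^ 2 = r ^ 2 := by
          simp only [hy, EuclideanSpace.norm_sq_eq, Real.norm_eq_abs, sq_abs, mul_pow,
            ← Finset.mul_sum, hsinsq]
          field_simp
        exact (pow_left_inj₀ (norm_nonneg _) hrpos.le two_ne_zero).1 this
      refine ⟨((u + v) / 2, y), ?_⟩
      have e1 : (u + v) / 2 + r = v := by rw [hr]; ring
      have e2 : (u + v) / 2 - r = u := by rw [hr]; ring
      simp only [minkowskiEmbedding, hyn, e1, e2, hP, hQ]
      have e3 : (T + χ) / 2 - (T - χ) / 2 = χ := by ring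
      rw [e3]
      refine Prod.ext ?_ ?_
      · simp only; ring
      · ext i
        refine Fin.cases ?_ (fun j => ?_) i
        · simp [hcos]
        · simp only [Fin.cons_succ, hy]
          field_simp

end

open Set Real Filter Topology InnerProductGeometry
open scoped ContDiff

/-!
The cylinder `ℝ × S^d` carries the causal structure of a product: a causal curve covers a spherical
distance (an angle) of at most the elapsed time, and a timelike curve less, and the null geodesics
are the great circles traversed at unit speed. Since `π - χ` is the distance to the south pole, `M̃`
consists of the points that are not timelike separated from `i⁰`, and `𝓘^±` form its light cone; by
the triangle inequality `M̃` is causally convex. So points of `M̃` at angle `θ` and time difference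
`t > 0` are timelike connected in `M̃` if and only if `θ < t`.

All light rays from `p = (T, ω)` refocus at `q = (T + π, -ω)`. Along a null geodesic from a point of
`𝓘` the conformal factor `Ω = cos T + cos χ` is a multiple `c sin τ` of the sine of the elapsed time
`τ`. Hence a ray from `p ∈ 𝓘⁻` enters `M = {Ω > 0}` if and only if `c > 0`, in which case it misses
`i⁰` and meets `𝓘⁺` exactly at `τ = π`, that is at `q`; otherwise `c = 0` and it passes through
`i⁰`.

For `r ∈ 𝓘⁺`, the triangle inequality through the south pole bounds the angle between `p` and `r` by
their time difference. If they are not timelike connected, equality holds, so `r` and `q` are null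
separated, and `Ω` vanishes at the end `q` of the ray from `r` to `q`, hence along the whole ray.
-/

section Calculus

variable {E F : Type*} [NormedAddCommGroup E] [NormedSpace ℝ E]
  [NormedAddCommGroup F] [NormedSpace ℝ F] {s : Set ℝ} {x y : ℝ}

lemma hasDerivWithinAt_fst {f : ℝ → E × F} {f' : E × F} (h : HasDerivWithinAt f f' s x) :
    HasDerivWithinAt (fun z => (f z).1) f'.1 s x :=
  (ContinuousLinearMap.fst ℝ E F).hasFDerivAt.comp_hasDerivWithinAt x h

lemma hasDerivWithinAt_snd {f : ℝ → E × F} {f' : E × F} (h : HasDerivWithinAt f f' s x) :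
    HasDerivWithinAt (fun z => (f z).2) f'.2 s x :=
  (ContinuousLinearMap.snd ℝ E F).hasFDerivAt.comp_hasDerivWithinAt x h

lemma eq_of_hasDerivWithinAt_zero {f : ℝ → E} (hs : Convex ℝ s)
    (hf : ∀ z ∈ s, HasDerivWithinAt f 0 s z) (hx : x ∈ s) (hy : y ∈ s) : f x = f y := by
  have := hs.norm_image_sub_le_of_norm_hasDerivWithin_le hf (fun _ _ => norm_zero.le) hy hx
  rwa [zero_mul, norm_le_zero_iff, sub_eq_zero] at this

lemma hasDerivWithinAt_norm_sub {f : ℝ → E} {f' : E} (hs : s ⊆ Ici x)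
    (h : HasDerivWithinAt f f' s x) : HasDerivWithinAt (fun z => ‖f z - f x‖) ‖f'‖ s x := by
  rw [hasDerivWithinAt_iff_tendsto_slope] at h ⊢
  refine h.norm.congr' ?_
  filter_upwards [self_mem_nhdsWithin] with z hz
  have hxz : 0 ≤ z - x := sub_nonneg.2 (hs hz.1)
  simp [slope, norm_smul, abs_of_nonneg hxz]

end Calculus

section GreatCircle

variable {E : Type*} [NormedAddCommGroup E]

/-- For orthonormal `v` and `u`, the great circle that starts at `v` in the direction `u`,
parametrized by arc length. -/
noncomputable def greatCircle [NormedSpace ℝ E] (v u : E) (t : ℝ) : E := cos t • v + sin t • u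

section NormedSpace

variable [NormedSpace ℝ E] {v u : E} {t : ℝ}

@[simp]
lemma greatCircle_zero : greatCircle v u 0 = v := by simp [greatCircle]

@[simp]
lemma greatCircle_pi : greatCircle v u π = -v := by simp [greatCircle]

lemma greatCircle_neg_neg : greatCircle (-v) (-u) t = -greatCircle v u t := by
  simp only [greatCircle, smul_neg, neg_add]

lemma hasDerivAt_greatCircle : HasDerivAt (greatCircle v u) (greatCircle u (-v) t) t := by
  refine (((hasDerivAt_cos t).smul_const v).add ((hasDerivAt_sin t).smul_const u)).congr_deriv ?_
  rw [greatCircle, smul_neg, neg_smul, add_comm]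

lemma hasDerivAt_greatCircle_mul {k : ℝ} :
    HasDerivAt (fun z => greatCircle v u (k * z)) (k • greatCircle u (-v) (k * t)) t :=
  hasDerivAt_greatCircle.scomp t (by simpa using (hasDerivAt_id t).const_mul k)

lemma contDiff_greatCircle {n : WithTop ℕ∞} : ContDiff ℝ n (greatCircle v u) :=
  (contDiff_cos.smul contDiff_const).add (contDiff_sin.smul contDiff_const)

lemma eq_greatCircle_of_hasDerivWithinAt {f g : ℝ → E} {k : ℝ} {s : Set ℝ} (hk : k ≠ 0)
    (hs : Convex ℝ s) (hf : ∀ z ∈ s, HasDerivWithinAt f (g z) s z)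
    (hg : ∀ z ∈ s, HasDerivWithinAt g (-(k ^ 2) • f z) s z) (h0 : 0 ∈ s) (ht : t ∈ s) :
    f t = greatCircle (f 0) (k⁻¹ • g 0) (k * t) := by
  have hkz (z : ℝ) : HasDerivAt (fun z => k * z) k z := by simpa using (hasDerivAt_id z).const_mul k
  have hcos (z : ℝ) : HasDerivWithinAt (fun z => cos (k * z)) (-sin (k * z) * k) s z :=
    (hkz z).cos.hasDerivWithinAt
  have hsin (z : ℝ) : HasDerivWithinAt (fun z => sin (k * z)) (cos (k * z) * k) s z :=
    (hkz z).sin.hasDerivWithinAt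
  -- Rotating the phase vector `(f, g / k)` back by the angle `k z` gives a constant of motion.
  have h1 : cos (k * t) • f t - sin (k * t) • k⁻¹ • g t = f 0 := by
    have h : ∀ z ∈ s, HasDerivWithinAt
        (fun z => cos (k * z) • f z - sin (k * z) • k⁻¹ • g z) 0 s z := fun z hz => by
      refine HasDerivWithinAt.congr_deriv (((hcos z).smul (hf z hz)).sub
        ((hsin z).smul ((hg z hz).const_smul k⁻¹))) ?_
      match_scalars <;> field_simp <;> ring
    simpa using eq_of_hasDerivWithinAt_zero hs h ht h0
  have h2 : sin (k * t) • f t + cos (k * t) • k⁻¹ • g t = k⁻¹ • g 0 := by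
    have h : ∀ z ∈ s, HasDerivWithinAt
        (fun z => sin (k * z) • f z + cos (k * z) • k⁻¹ • g z) 0 s z := fun z hz => by
      refine HasDerivWithinAt.congr_deriv (((hsin z).smul (hf z hz)).add
        ((hcos z).smul ((hg z hz).const_smul k⁻¹))) ?_
      match_scalars <;> field_simp <;> ring
    simpa using eq_of_hasDerivWithinAt_zero hs h ht h0
  rw [greatCircle, ← h1, ← h2]
  match_scalars
  · linarith [sin_sq_add_cos_sq (k * t)]
  · ring

end NormedSpace

variable [InnerProductSpace ℝ E] {v w u : E} {s t : ℝ}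

lemma inner_greatCircle (hv : ‖v‖ = 1) (hu : ‖u‖ = 1) (hvu : inner ℝ v u = 0) :
    inner ℝ (greatCircle v u s) (greatCircle v u t) = cos (t - s) := by
  simp only [greatCircle, inner_add_left, inner_add_right, real_inner_smul_left,
    real_inner_smul_right, inner_self_eq_one_of_norm_eq_one hv,
    inner_self_eq_one_of_norm_eq_one hu, hvu, real_inner_comm v u, cos_sub]
  ring

lemma norm_greatCircle (hv : ‖v‖ = 1) (hu : ‖u‖ = 1) (hvu : inner ℝ v u = 0) :
    ‖greatCircle v u t‖ = 1 := by
  rw [← sq_eq_sq₀ (norm_nonneg _) zero_le_one, ← real_inner_self_eq_norm_sq,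
    inner_greatCircle hv hu hvu, sub_self, cos_zero, one_pow]

lemma angle_greatCircle (hv : ‖v‖ = 1) (hu : ‖u‖ = 1) (hvu : inner ℝ v u = 0) (hst : s ≤ t)
    (hπ : t - s ≤ π) : angle (greatCircle v u s) (greatCircle v u t) = t - s := by
  rw [angle, inner_greatCircle hv hu hvu, norm_greatCircle hv hu hvu, norm_greatCircle hv hu hvu,
    one_mul, div_one, arccos_cos (sub_nonneg.2 hst) hπ]

lemma exists_norm_eq_one_inner_eq_zero (hE : 1 < Module.rank ℝ E) (v : E) :
    ∃ u : E, ‖u‖ = 1 ∧ inner ℝ v u = 0 := by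
  have hne : (Submodule.span ℝ {v})ᗮ ≠ ⊥ := fun h => by
    rw [Submodule.orthogonal_eq_bot_iff] at h
    have := rank_span_le (R := ℝ) ({v} : Set E)
    rw [h, rank_top, Cardinal.mk_singleton] at this
    exact this.not_gt hE
  obtain ⟨n, hn, hn0⟩ := Submodule.exists_mem_ne_zero_of_ne_bot hne
  refine ⟨(‖n‖⁻¹ : ℝ) • n, norm_smul_inv_norm hn0, ?_⟩
  rw [real_inner_smul_right, Submodule.mem_orthogonal_singleton_iff_inner_right.1 hn, mul_zero]

lemma exists_greatCircle_eq (hE : 1 < Module.rank ℝ E) (hv : ‖v‖ = 1) (hw : ‖w‖ = 1) :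
    ∃ u : E, ‖u‖ = 1 ∧ inner ℝ v u = 0 ∧ greatCircle v u (angle v w) = w := by
  rcases eq_or_ne (sin (angle v w)) 0 with hs | hs
  · obtain ⟨u, hu, hvu⟩ := exists_norm_eq_one_inner_eq_zero hE v
    refine ⟨u, hu, hvu, ?_⟩
    rcases sin_eq_zero_iff_angle_eq_zero_or_angle_eq_pi.1 hs with h | h
    · rw [h, greatCircle_zero, eq_of_angle_eq_zero_of_norm_eq h (hv.trans hw.symm)]
    · rw [h, greatCircle_pi, eq_comm, ← neg_eq_iff_eq_neg]
      refine (eq_of_angle_eq_zero_of_norm_eq ?_ (by rw [norm_neg, hv, hw])).symm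
      rw [angle_neg_right, h, sub_self]
  · have hc := inner_eq_cos_angle_of_norm_eq_one hv hw
    refine ⟨(sin (angle v w))⁻¹ • (w - cos (angle v w) • v), ?_, ?_, ?_⟩
    · rw [norm_smul, norm_inv, norm_of_nonneg (sin_angle_nonneg v w), inv_mul_eq_one₀ hs,
        ← sq_eq_sq₀ (sin_angle_nonneg v w) (norm_nonneg _), norm_sub_sq_real, norm_smul, hv, hw,
        real_inner_smul_right, real_inner_comm, hc, sin_sq]
      simp only [norm_eq_abs, mul_one, sq_abs]
      ring
    · rw [real_inner_smul_right, inner_sub_right, real_inner_smul_right, hc,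
        inner_self_eq_one_of_norm_eq_one hv, mul_one, sub_self, mul_zero]
    · rw [greatCircle, smul_inv_smul₀ hs, add_sub_cancel]

end GreatCircle

section SphericalLength

variable {E : Type*} [NormedAddCommGroup E] [InnerProductSpace ℝ E]

lemma norm_sub_eq_two_mul_sin_half_angle {u v : E} (hu : ‖u‖ = 1) (hv : ‖v‖ = 1) :
    ‖u - v‖ = 2 * sin (angle u v / 2) := by
  have hsin : 0 ≤ sin (angle u v / 2) := sin_nonneg_of_nonneg_of_le_pi
    (by linarith [angle_nonneg u v]) (by linarith [angle_nonneg u v, angle_le_pi u v])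
  rw [← sq_eq_sq₀ (norm_nonneg _) (by positivity), norm_sub_sq_real, hu, hv,
    inner_eq_cos_angle_of_norm_eq_one hu hv, mul_pow, sin_sq_eq_half_sub,
    mul_div_cancel₀ _ two_ne_zero]
  ring

lemma angle_eq_two_mul_arcsin {u v : E} (hu : ‖u‖ = 1) (hv : ‖v‖ = 1) :
    angle u v = 2 * arcsin (‖u - v‖ / 2) := by
  have h0 := angle_nonneg u v
  have hπ := angle_le_pi u v
  rw [norm_sub_eq_two_mul_sin_half_angle hu hv, mul_div_cancel_left₀ _ two_ne_zero,
    arcsin_sin (by linarith) (by linarith), mul_div_cancel₀ _ two_ne_zero]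

lemma hasDerivWithinAt_angle {f : ℝ → E} {f' : E} {s : Set ℝ} {x : ℝ} (hs : s ⊆ Ici x)
    (hx : x ∈ s) (hn : ∀ z ∈ s, ‖f z‖ = 1) (h : HasDerivWithinAt f f' s x) :
    HasDerivWithinAt (fun z => angle (f x) (f z)) ‖f'‖ s x := by
  have harcsin : HasDerivAt (fun y : ℝ => 2 * arcsin (y / 2)) 1 ‖f x - f x‖ := by
    have h0 : HasDerivAt arcsin 1 (‖f x - f x‖ / 2) := by
      simpa using hasDerivAt_arcsin (x := 0) (by norm_num) (by norm_num)
    have h2 : HasDerivAt (fun y : ℝ => y / 2) (1 / 2) ‖f x - f x‖ := (hasDerivAt_id _).div_const 2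
    simpa [Function.comp_def] using (HasDerivAt.comp (‖f x - f x‖) h0 h2).const_mul 2
  have hchord := harcsin.comp_hasDerivWithinAt x (hasDerivWithinAt_norm_sub hs h)
  rw [one_mul] at hchord
  refine hchord.congr_of_mem (fun z hz => ?_) hx
  rw [Function.comp_apply, angle_eq_two_mul_arcsin (hn x hx) (hn z hz), norm_sub_rev]

lemma angle_le_of_norm_deriv_le {f f' : ℝ → E} {B B' : ℝ → ℝ} {a b : ℝ} (hab : a ≤ b)
    (hf : ∀ s ∈ Icc a b, HasDerivWithinAt f (f' s) (Icc a b) s)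
    (hB : ∀ s ∈ Icc a b, HasDerivWithinAt B (B' s) (Icc a b) s)
    (hn : ∀ s ∈ Icc a b, ‖f s‖ = 1) (hle : ∀ s ∈ Icc a b, ‖f' s‖ ≤ B' s) :
    angle (f a) (f b) ≤ B b - B a := by
  have hne : ∀ s ∈ Icc a b, f s ≠ 0 := fun s hs => norm_ne_zero_iff.1 (by simp [hn s hs])
  have ha : a ∈ Icc a b := left_mem_Icc.2 hab
  have hcont : ContinuousOn (fun s => angle (f a) (f s)) (Icc a b) := fun s hs =>
    ContinuousAt.comp_continuousWithinAt (f := fun s => (f a, f s))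
      (continuousAt_angle (hne a ha) (hne s hs))
      (continuousWithinAt_const.prodMk (hf s hs).continuousWithinAt)
  have hBcont : ContinuousOn B (Icc a b) := fun s hs => (hB s hs).continuousWithinAt
  suffices key : ∀ ⦃x⦄, x ∈ Icc a b → angle (f a) (f x) ≤ B x - B a from key (right_mem_Icc.2 hab)
  refine image_le_of_liminf_slope_right_le_deriv_boundary (B' := B') hcont
    (by simp [angle_self (hne a ha)]) (hBcont.sub continuousOn_const)
    (fun x hx => ?_) (fun x hx r hr => ?_)
  · exact ((hB x ⟨hx.1, hx.2.le⟩).sub_const (B a)).mono_of_mem_nhdsWithin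
      (mem_of_superset (Icc_mem_nhdsGE hx.2) (Icc_subset_Icc_left hx.1))
  · have hxI : x ∈ Icc a b := ⟨hx.1, hx.2.le⟩
    have hsub : Icc x b ⊆ Icc a b := Icc_subset_Icc_left hx.1
    have hangle : HasDerivWithinAt (fun z => angle (f x) (f z)) ‖f' x‖ (Ioi x) x :=
      (hasDerivWithinAt_angle Icc_subset_Ici_self (left_mem_Icc.2 hx.2.le)
        (fun z hz => hn z (hsub hz)) ((hf x hxI).mono hsub)).mono_of_mem_nhdsWithin
        (Icc_mem_nhdsGT hx.2)
    rw [hasDerivWithinAt_iff_tendsto_slope' self_notMem_Ioi] at hangle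
    refine Eventually.frequently ?_
    filter_upwards [hangle.eventually_lt_const ((hle x hxI).trans_lt hr), self_mem_nhdsWithin]
      with z hz hxz
    refine lt_of_le_of_lt ?_ hz
    have hpos : 0 < z - x := sub_pos.2 hxz
    rw [slope_def_field, slope_def_field, angle_self (hne x hxI), sub_zero]
    gcongr
    linarith [angle_le_angle_add_angle (f a) (f x) (f z)]

end SphericalLength

section CompactifiedMinkowski

variable {d : ℕ} {a b x : Ambient d}

lemma norm_southPole : ‖(spatialInfinity d).2‖ = 1 := by simp [spatialInfinity]

lemma inner_southPole (w : EuclideanSpace ℝ (Fin (d + 1))) :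
    inner ℝ w (spatialInfinity d).2 = -w 0 := by
  simp [spatialInfinity, inner_neg_right, EuclideanSpace.inner_single_right]

lemma angle_southPole (hx : ‖x.2‖ = 1) :
    angle x.2 (spatialInfinity d).2 = π - polarAngle x := by
  rw [angle, inner_southPole, hx, norm_southPole, one_mul, div_one, arccos_neg, polarAngle]

lemma mem_compactifiedMinkowski_iff_abs_le_angle :
    x ∈ compactifiedMinkowski d ↔ ‖x.2‖ = 1 ∧ |x.1| ≤ angle x.2 (spatialInfinity d).2 :=
  and_congr_right fun hx => by rw [angle_southPole hx]

lemma mem_compactifiedMinkowski_of_angle_le (ha : a ∈ compactifiedMinkowski d)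
    (hb : b ∈ compactifiedMinkowski d) (hx : ‖x.2‖ = 1) (hax : angle a.2 x.2 ≤ x.1 - a.1)
    (hxb : angle x.2 b.2 ≤ b.1 - x.1) : x ∈ compactifiedMinkowski d := by
  rw [mem_compactifiedMinkowski_iff_abs_le_angle, abs_le] at *
  have htri_a := angle_le_angle_add_angle a.2 x.2 (spatialInfinity d).2
  have htri_b := angle_le_angle_add_angle b.2 x.2 (spatialInfinity d).2
  rw [angle_comm b.2 x.2] at htri_b
  exact ⟨hx, by linarith [ha.2.1], by linarith [hb.2.2]⟩

/-- The conformal factor `Ω = cos T + cos χ = 2 cos P cos Q` of the compactification (`x.2 0` is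
`cos χ`): `Ω²` times the Minkowski metric is the metric of the cylinder. It is positive on `M` and
vanishes on `𝓘^±`. -/
noncomputable def conformalFactor (x : Ambient d) : ℝ := cos x.1 + x.2 0

lemma conformalFactor_eq (hx : ‖x.2‖ = 1) :
    conformalFactor x = cos |x.1| - cos (angle x.2 (spatialInfinity d).2) := by
  rw [← inner_eq_cos_angle_of_norm_eq_one hx norm_southPole, inner_southPole, sub_neg_eq_add,
    cos_abs, conformalFactor]

lemma mem_compactifiedMinkowski_iff :
    x ∈ compactifiedMinkowski d ↔ ‖x.2‖ = 1 ∧ |x.1| ≤ π ∧ 0 ≤ conformalFactor x := by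
  rw [mem_compactifiedMinkowski_iff_abs_le_angle]
  refine and_congr_right fun hx => ?_
  have hπ := angle_le_pi x.2 (spatialInfinity d).2
  rw [← and_iff_right_of_imp (a := |x.1| ≤ π) (b := |x.1| ≤ angle x.2 _) fun h => h.trans hπ]
  refine and_congr_right fun hT => ?_
  rw [conformalFactor_eq hx, sub_nonneg,
    strictAntiOn_cos.le_iff_ge ⟨angle_nonneg _ _, hπ⟩ ⟨abs_nonneg _, hT⟩]

lemma mem_physicalSpacetime_iff :
    x ∈ physicalSpacetime d ↔ ‖x.2‖ = 1 ∧ |x.1| ≤ π ∧ 0 < conformalFactor x := by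
  rw [physicalSpacetime_eq]
  refine and_congr_right fun hx => ?_
  have hπ := angle_le_pi x.2 (spatialInfinity d).2
  rw [← angle_southPole hx,
    ← and_iff_right_of_imp (a := |x.1| ≤ π) (b := |x.1| < angle x.2 _) fun h => h.le.trans hπ]
  refine and_congr_right fun hT => ?_
  rw [conformalFactor_eq hx, sub_pos,
    strictAntiOn_cos.lt_iff_gt ⟨angle_nonneg _ _, hπ⟩ ⟨abs_nonneg _, hT⟩]

lemma mem_scriPlus_iff :
    x ∈ scriPlus d ↔ ‖x.2‖ = 1 ∧ x.1 ∈ Ioo 0 π ∧ conformalFactor x = 0 := by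
  refine and_congr_right fun hx => ?_
  have hangle := angle_southPole hx
  have h0 := angle_nonneg x.2 (spatialInfinity d).2
  have hπ := angle_le_pi x.2 (spatialInfinity d).2
  rw [conformalFactor_eq hx, sub_eq_zero, ← hangle]
  constructor
  · rintro ⟨hχ0, hχπ, hT⟩
    rw [hT, abs_of_nonneg h0]
    exact ⟨⟨by linarith, by linarith⟩, rfl⟩
  · rintro ⟨hT, hΩ⟩
    have h := injOn_cos ⟨abs_nonneg _, by rw [abs_of_pos hT.1]; exact hT.2.le⟩ ⟨h0, hπ⟩ hΩ
    rw [abs_of_pos hT.1] at h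
    exact ⟨by linarith [hT.2], by linarith [hT.1], h⟩

lemma mem_scriMinus_iff :
    x ∈ scriMinus d ↔ ‖x.2‖ = 1 ∧ x.1 ∈ Ioo (-π) 0 ∧ conformalFactor x = 0 := by
  have hreflect : x ∈ scriMinus d ↔ (-x.1, x.2) ∈ scriPlus d := by
    simp only [scriMinus, scriPlus, polarAngle, mem_ofPred_eq, neg_eq_iff_eq_neg]
  rw [hreflect, mem_scriPlus_iff]
  simp only [conformalFactor, cos_neg, mem_Ioo, Left.neg_pos_iff, neg_lt (a := x.1), and_comm]

lemma scriPlus_subset : scriPlus d ⊆ compactifiedMinkowski d := fun x hx => by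
  obtain ⟨hn, hT, hΩ⟩ := mem_scriPlus_iff.1 hx
  exact mem_compactifiedMinkowski_iff.2 ⟨hn, abs_le.2 ⟨by linarith [hT.1, pi_pos], hT.2.le⟩, hΩ.ge⟩

lemma scriMinus_subset : scriMinus d ⊆ compactifiedMinkowski d := fun x hx => by
  obtain ⟨hn, hT, hΩ⟩ := mem_scriMinus_iff.1 hx
  exact mem_compactifiedMinkowski_iff.2 ⟨hn, abs_le.2 ⟨hT.1.le, by linarith [hT.2, pi_pos]⟩, hΩ.ge⟩

lemma eq_spatialInfinity (hx : x ∈ compactifiedMinkowski d) (hT : x.1 = 0)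
    (hΩ : conformalFactor x = 0) : x = spatialInfinity d := by
  refine Prod.ext hT ((inner_eq_one_iff_of_norm_eq_one (𝕜 := ℝ) hx.1 norm_southPole).1 ?_)
  rw [conformalFactor, hT, cos_zero] at hΩ
  rw [inner_southPole]
  linarith

lemma conformalFactor_spatialInfinity : conformalFactor (spatialInfinity d) = 0 := by
  simp [conformalFactor, spatialInfinity]

lemma angle_le_of_mem_scri (ha : a ∈ scriMinus d) (hb : b ∈ scriPlus d) :
    angle a.2 b.2 ≤ b.1 - a.1 := by
  have htri := angle_le_angle_add_angle a.2 (spatialInfinity d).2 b.2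
  rw [angle_comm (spatialInfinity d).2, angle_southPole ha.1, angle_southPole hb.1] at htri
  linarith [ha.2.2.2, hb.2.2.2]

end CompactifiedMinkowski

section GreatCircleCurve

variable {d : ℕ}

/-- The curve in the cylinder that starts at `a`, runs along the great circle with initial direction
`u` at angular speed `δ`, and along which time passes at the rate `k`. -/
noncomputable def greatCircleCurve (a : Ambient d) (u : EuclideanSpace ℝ (Fin (d + 1)))
    (k δ s : ℝ) : Ambient d := (a.1 + k * s, greatCircle a.2 u (δ * s))

variable {a : Ambient d} {u : EuclideanSpace ℝ (Fin (d + 1))} {k δ s : ℝ}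

lemma hasDerivAt_greatCircleCurve :
    HasDerivAt (greatCircleCurve a u k δ) (k, δ • greatCircle u (-a.2) (δ * s)) s := by
  have hT : HasDerivAt (fun s => a.1 + k * s) k s := by
    simpa using ((hasDerivAt_id s).const_mul k).const_add a.1
  exact hT.prodMk hasDerivAt_greatCircle_mul

lemma velocity_greatCircleCurve (hs : s ∈ Icc (0 : ℝ) 1) :
    velocity (greatCircleCurve a u k δ) s = (k, δ • greatCircle u (-a.2) (δ * s)) :=
  hasDerivAt_greatCircleCurve.hasDerivWithinAt.derivWithin (uniqueDiffOn_Icc one_pos s hs)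

lemma acceleration_greatCircleCurve (hs : s ∈ Icc (0 : ℝ) 1) :
    acceleration (greatCircleCurve a u k δ) s =
      (0, -(δ ^ 2) • (greatCircleCurve a u k δ s).2) := by
  have h : HasDerivAt (fun s => ((k, δ • greatCircle u (-a.2) (δ * s)) : Ambient d))
      (0, -(δ ^ 2) • (greatCircleCurve a u k δ s).2) s := by
    refine (hasDerivAt_const s k).prodMk
      ((hasDerivAt_greatCircle_mul.const_smul δ).congr_deriv ?_)
    rw [greatCircle_neg_neg, greatCircleCurve, smul_smul, smul_neg, neg_smul, pow_two]
  exact (h.hasDerivWithinAt.congr_of_mem (fun _ => velocity_greatCircleCurve) hs).derivWithin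
    (uniqueDiffOn_Icc one_pos s hs)

lemma norm_velocity_greatCircleCurve (ha : ‖a.2‖ = 1) (hu : ‖u‖ = 1) (hau : inner ℝ a.2 u = 0)
    (hs : s ∈ Icc (0 : ℝ) 1) : ‖(velocity (greatCircleCurve a u k δ) s).2‖ = |δ| := by
  have hua : inner ℝ u (-a.2) = 0 := by rw [inner_neg_right, real_inner_comm, hau, neg_zero]
  rw [velocity_greatCircleCurve hs, norm_smul, norm_greatCircle hu (by rwa [norm_neg]) hua,
    mul_one, norm_eq_abs]

lemma lineElement_greatCircleCurve (ha : ‖a.2‖ = 1) (hu : ‖u‖ = 1) (hau : inner ℝ a.2 u = 0)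
    (hs : s ∈ Icc (0 : ℝ) 1) :
    lineElement (velocity (greatCircleCurve a u k δ) s) = k ^ 2 - δ ^ 2 := by
  rw [lineElement, norm_velocity_greatCircleCurve ha hu hau hs, velocity_greatCircleCurve hs,
    sq_abs]

lemma isFutureDirected_greatCircleCurve (hk : 0 < k) :
    IsFutureDirected (greatCircleCurve a u k δ) := fun s hs => by
  rwa [velocity_greatCircleCurve hs]

lemma isSmoothCurve_greatCircleCurve
    (hmem : ∀ s ∈ Icc (0 : ℝ) 1, greatCircleCurve a u k δ s ∈ compactifiedMinkowski d) :
    IsSmoothCurve (greatCircleCurve a u k δ) a (greatCircleCurve a u k δ 1) where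
  smooth := ((contDiff_const.add (contDiff_const.mul contDiff_id)).prodMk
    (contDiff_greatCircle.comp (contDiff_const.mul contDiff_id))).contDiffOn
  mem := hmem
  source := by simp [greatCircleCurve]
  target := rfl

lemma isFutureNullGeodesic_greatCircleCurve (ha : ‖a.2‖ = 1) (hu : ‖u‖ = 1)
    (hau : inner ℝ a.2 u = 0) (hk : 0 < k)
    (hmem : ∀ s ∈ Icc (0 : ℝ) 1, greatCircleCurve a u k k s ∈ compactifiedMinkowski d) :
    IsFutureNullGeodesic (greatCircleCurve a u k k) a (greatCircleCurve a u k k 1) where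
  toIsSmoothCurve := isSmoothCurve_greatCircleCurve hmem
  geodesic s hs := by
    rw [acceleration_greatCircleCurve hs, norm_velocity_greatCircleCurve ha hu hau hs, sq_abs]
  null s hs := by
    refine ⟨fun h => ?_, by rw [lineElement_greatCircleCurve ha hu hau hs, sub_self]⟩
    rw [velocity_greatCircleCurve hs] at h
    exact hk.ne' (congrArg Prod.fst h)
  future := isFutureDirected_greatCircleCurve hk

lemma conformalFactor_greatCircleCurve (ha : conformalFactor a = 0) :
    conformalFactor (greatCircleCurve a u k k s) = sin (k * s) * (u 0 - sin a.1) := by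
  have ha0 : a.2 0 = -cos a.1 := by rw [conformalFactor] at ha; linarith
  simp only [conformalFactor, greatCircleCurve, greatCircle, PiLp.add_apply, PiLp.smul_apply,
    smul_eq_mul, ha0, cos_add]
  ring

end GreatCircleCurve

section Curves

variable {d : ℕ} {γ : ℝ → Ambient d} {a b : Ambient d} {s : ℝ}

namespace IsSmoothCurve

lemma hasDerivWithinAt (h : IsSmoothCurve γ a b) (hs : s ∈ Icc (0 : ℝ) 1) :
    HasDerivWithinAt γ (velocity γ s) (Icc 0 1) s :=
  (h.smooth.differentiableOn (by simp) s hs).hasDerivWithinAt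

lemma contDiffOn_velocity (h : IsSmoothCurve γ a b) : ContDiffOn ℝ ∞ (velocity γ) (Icc 0 1) :=
  h.smooth.derivWithin (uniqueDiffOn_Icc one_pos) (by simp)

lemma hasDerivWithinAt_velocity (h : IsSmoothCurve γ a b) (hs : s ∈ Icc (0 : ℝ) 1) :
    HasDerivWithinAt (velocity γ) (acceleration γ s) (Icc 0 1) s :=
  (h.contDiffOn_velocity.differentiableOn (by simp) s hs).hasDerivWithinAt

lemma angle_le {ε : ℝ} (h : IsSmoothCurve γ a b)
    (hle : ∀ s ∈ Icc (0 : ℝ) 1, ‖(velocity γ s).2‖ ≤ (velocity γ s).1 - ε) :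
    angle a.2 b.2 ≤ b.1 - a.1 - ε := by
  have hB (s : ℝ) (hs : s ∈ Icc (0 : ℝ) 1) : HasDerivWithinAt (fun s => (γ s).1 - ε * s)
      ((velocity γ s).1 - ε) (Icc 0 1) s := by
    have := (hasDerivWithinAt_fst (h.hasDerivWithinAt hs)).sub
      ((hasDerivWithinAt_id s _).const_mul ε)
    rwa [mul_one] at this
  have := angle_le_of_norm_deriv_le zero_le_one
    (fun s hs => hasDerivWithinAt_snd (h.hasDerivWithinAt hs)) hB (fun s hs => (h.mem s hs).1) hle
  rw [h.source, h.target] at this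
  linarith

end IsSmoothCurve

lemma angle_le_of_mem_causalFuture (ha : ‖a.2‖ = 1) (h : b ∈ causalFuture a) :
    angle a.2 b.2 ≤ b.1 - a.1 := by
  rcases h.2 with rfl | ⟨γ, hγ, hcausal, hfuture⟩
  · rw [angle_self (norm_ne_zero_iff.1 (ha.trans_ne one_ne_zero)), sub_self]
  · rw [← sub_zero (b.1 - a.1)]
    refine hγ.angle_le fun s hs => ?_
    rw [sub_zero]
    exact le_of_sq_le_sq (sub_nonneg.1 (hcausal s hs).2) (hfuture s hs).le

namespace IsTimelike

lemma norm_velocity_lt (h : IsTimelike γ) (hs : s ∈ Icc (0 : ℝ) 1) :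
    ‖(velocity γ s).2‖ < |(velocity γ s).1| :=
  lt_of_pow_lt_pow_left₀ 2 (abs_nonneg _) (by rw [sq_abs]; exact sub_pos.1 (h s hs))

lemma isFutureDirected (h : IsTimelike γ) (hγ : IsSmoothCurve γ a b) (hab : a.1 < b.1) :
    IsFutureDirected γ := by
  have hT (s : ℝ) (hs : s ∈ Icc (0 : ℝ) 1) := hasDerivWithinAt_fst (hγ.hasDerivWithinAt hs)
  have hne (s : ℝ) (hs : s ∈ Icc (0 : ℝ) 1) : (velocity γ s).1 ≠ 0 :=
    abs_pos.1 ((norm_nonneg _).trans_lt (h.norm_velocity_lt hs))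
  refine (hasDerivWithinAt_forall_lt_or_forall_gt_of_forall_ne (convex_Icc 0 1) hT hne).resolve_left
    fun hneg => hab.not_ge ?_
  have hanti : AntitoneOn (fun s => (γ s).1) (Icc 0 1) :=
    antitoneOn_of_hasDerivWithinAt_nonpos (convex_Icc 0 1)
      (fun s hs => (hT s hs).continuousWithinAt)
      (fun s hs => (hT s (interior_subset hs)).mono interior_subset)
      (fun s hs => (hneg s (interior_subset hs)).le)
  simpa only [hγ.source, hγ.target] using
    hanti (left_mem_Icc.2 zero_le_one) (right_mem_Icc.2 zero_le_one) zero_le_one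

lemma angle_lt (h : IsTimelike γ) (hγ : IsSmoothCurve γ a b) (hfuture : IsFutureDirected γ) :
    angle a.2 b.2 < b.1 - a.1 := by
  have hcont : ContinuousOn (fun s => (velocity γ s).1 - ‖(velocity γ s).2‖) (Icc 0 1) :=
    hγ.contDiffOn_velocity.continuousOn.fst.sub hγ.contDiffOn_velocity.continuousOn.snd.norm
  obtain ⟨s, hs, hmin⟩ := isCompact_Icc.exists_isMinOn (nonempty_Icc.2 zero_le_one) hcont
  have hpos : 0 < (velocity γ s).1 - ‖(velocity γ s).2‖ := by
    rw [sub_pos, ← abs_of_pos (hfuture s hs)]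
    exact h.norm_velocity_lt hs
  have hle := hγ.angle_le fun z hz => le_sub_comm.1 (hmin hz)
  linarith

end IsTimelike

namespace IsFutureNullGeodesic

lemma norm_velocity (h : IsFutureNullGeodesic γ a b) (hs : s ∈ Icc (0 : ℝ) 1) :
    ‖(velocity γ s).2‖ = (velocity γ s).1 :=
  ((sq_eq_sq₀ (h.future s hs).le (norm_nonneg _)).1 (sub_eq_zero.1 (h.null s hs).2)).symm

lemma velocity_fst (h : IsFutureNullGeodesic γ a b) (hs : s ∈ Icc (0 : ℝ) 1) :
    (velocity γ s).1 = (velocity γ 0).1 :=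
  eq_of_hasDerivWithinAt_zero (convex_Icc 0 1) (fun z hz =>
    (hasDerivWithinAt_fst (h.hasDerivWithinAt_velocity hz)).congr_deriv
      (congrArg Prod.fst (h.geodesic z hz))) hs (left_mem_Icc.2 zero_le_one)

lemma fst_eq (h : IsFutureNullGeodesic γ a b) (hs : s ∈ Icc (0 : ℝ) 1) :
    (γ s).1 = a.1 + (velocity γ 0).1 * s := by
  have hderiv (z : ℝ) (hz : z ∈ Icc (0 : ℝ) 1) :
      HasDerivWithinAt (fun z => (γ z).1 - (velocity γ 0).1 * z) 0 (Icc 0 1) z := by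
    have := (hasDerivWithinAt_fst (h.hasDerivWithinAt hz)).sub
      ((hasDerivWithinAt_id z _).const_mul (velocity γ 0).1)
    rwa [h.velocity_fst hz, mul_one, sub_self] at this
  have := eq_of_hasDerivWithinAt_zero (convex_Icc 0 1) hderiv hs (left_mem_Icc.2 zero_le_one)
  rw [mul_zero, sub_zero, h.source] at this
  linarith

lemma exists_eq_greatCircleCurve (h : IsFutureNullGeodesic γ a b) :
    ∃ k > 0, ∃ u, ∀ s ∈ Icc (0 : ℝ) 1, γ s = greatCircleCurve a u k k s := by
  have h0 : (0 : ℝ) ∈ Icc (0 : ℝ) 1 := left_mem_Icc.2 zero_le_one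
  have hk := h.future 0 h0
  refine ⟨(velocity γ 0).1, hk, (velocity γ 0).1⁻¹ • (velocity γ 0).2, fun s hs =>
    Prod.ext (h.fst_eq hs) ?_⟩
  have := eq_greatCircle_of_hasDerivWithinAt hk.ne' (convex_Icc 0 1)
    (fun z hz => hasDerivWithinAt_snd (h.hasDerivWithinAt hz))
    (fun z hz => (hasDerivWithinAt_snd (h.hasDerivWithinAt_velocity hz)).congr_deriv (by
      rw [h.geodesic z hz, h.norm_velocity hz, h.velocity_fst hz])) h0 hs
  rwa [h.source] at this

lemma mem_causalFuture (h : IsFutureNullGeodesic γ a b) : b ∈ causalFuture a :=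
  ⟨h.target ▸ h.mem 1 (right_mem_Icc.2 zero_le_one), .inr ⟨γ, h.toIsSmoothCurve,
    fun s hs => ⟨(h.null s hs).1, (h.null s hs).2.ge⟩, h.future⟩⟩

end IsFutureNullGeodesic

lemma one_lt_rank_euclideanSpace (hd : 1 ≤ d) :
    1 < Module.rank ℝ (EuclideanSpace ℝ (Fin (d + 1))) := by
  simpa using Module.lt_rank_of_lt_finrank
    ((Nat.lt_succ_of_le hd).trans_eq (finrank_euclideanSpace_fin (𝕜 := ℝ)).symm)

lemma exists_isSmoothCurve_isTimelike (hd : 1 ≤ d) (ha : a ∈ compactifiedMinkowski d)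
    (hb : b ∈ compactifiedMinkowski d) (h : angle a.2 b.2 < b.1 - a.1) :
    ∃ γ, IsSmoothCurve γ a b ∧ IsTimelike γ ∧ IsFutureDirected γ := by
  obtain ⟨u, hu, hau, hub⟩ := exists_greatCircle_eq (one_lt_rank_euclideanSpace hd) ha.1 hb.1
  have hk : 0 < b.1 - a.1 := (angle_nonneg _ _).trans_lt h
  have hδ := angle_nonneg a.2 b.2
  have hπ := angle_le_pi a.2 b.2
  set k := b.1 - a.1 with hk_def
  set δ := angle a.2 b.2
  have hend : greatCircleCurve a u k δ 1 = b := by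
    rw [greatCircleCurve, mul_one, mul_one, hub, hk_def, add_sub_cancel]
  refine ⟨greatCircleCurve a u k δ, ?_, ?_, isFutureDirected_greatCircleCurve hk⟩
  · rw [← hend]
    refine isSmoothCurve_greatCircleCurve fun s hs => mem_compactifiedMinkowski_of_angle_le ha hb
      (norm_greatCircle ha.1 hu hau) ?_ ?_
    · have hangle := angle_greatCircle (s := 0) (t := δ * s) ha.1 hu hau
        (mul_nonneg hδ hs.1) (by nlinarith [hs.2])
      rw [greatCircle_zero] at hangle
      simp only [greatCircleCurve, hangle]
      nlinarith [hs.1]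
    · have hangle := angle_greatCircle (s := δ * s) (t := δ) ha.1 hu hau
        (mul_le_of_le_one_right hδ hs.2) (by nlinarith [hs.1])
      rw [hub] at hangle
      simp only [greatCircleCurve, hangle]
      nlinarith [hs.2]
  · intro s hs
    rw [lineElement_greatCircleCurve ha.1 hu hau hs, sub_pos]
    exact pow_lt_pow_left₀ h hδ two_ne_zero

lemma mem_chronologicalFuture_iff (hd : 1 ≤ d) (ha : a ∈ compactifiedMinkowski d)
    (hb : b ∈ compactifiedMinkowski d) :
    b ∈ chronologicalFuture a ↔ angle a.2 b.2 < b.1 - a.1 :=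
  ⟨fun ⟨_, _, hγ, htime, hfuture⟩ => htime.angle_lt hγ hfuture,
    fun h => ⟨hb, exists_isSmoothCurve_isTimelike hd ha hb h⟩⟩

lemma timelikeConnected_iff (hd : 1 ≤ d) (ha : a ∈ compactifiedMinkowski d)
    (hb : b ∈ compactifiedMinkowski d) (hab : a.1 < b.1) :
    TimelikeConnected a b ↔ angle a.2 b.2 < b.1 - a.1 := by
  refine ⟨fun ⟨γ, hγ, htime⟩ => htime.angle_lt hγ (htime.isFutureDirected hγ hab), fun h => ?_⟩
  obtain ⟨γ, hγ, htime, -⟩ := exists_isSmoothCurve_isTimelike hd ha hb h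
  exact ⟨γ, hγ, htime⟩

end Curves

section Scri

variable {d : ℕ} {γ : ℝ → Ambient d} {p q r : Ambient d}

/-- The point at which the light rays from `p` refocus: the antipodal point of the sphere, a time
`π` later. For `p ∈ 𝓘⁻` it is the point `q ∈ 𝓘⁺` of the theorem. -/
noncomputable def refocusPoint (p : Ambient d) : Ambient d := (p.1 + π, -p.2)

lemma refocusPoint_mem_scriPlus (hp : p ∈ scriMinus d) : refocusPoint p ∈ scriPlus d := by
  obtain ⟨hn, hT, hΩ⟩ := mem_scriMinus_iff.1 hp
  refine mem_scriPlus_iff.2 ⟨(norm_neg p.2).trans hn, ⟨by simp only [refocusPoint]; linarith [hT.1],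
    by simp only [refocusPoint]; linarith [hT.2]⟩, ?_⟩
  simp only [conformalFactor, refocusPoint, cos_add_pi, PiLp.neg_apply] at hΩ ⊢
  linarith

lemma exists_isFutureNullGeodesic_refocusPoint (hd : 1 ≤ d) (hp : p ∈ scriMinus d) :
    ∃ γ, IsFutureNullGeodesic γ p (refocusPoint p) ∧ EntersPhysical γ := by
  obtain ⟨hn, hT, hΩ⟩ := mem_scriMinus_iff.1 hp
  obtain ⟨u, hu, hpu, hu0⟩ : ∃ u, ‖u‖ = 1 ∧ inner ℝ p.2 u = 0 ∧ 0 ≤ u 0 := by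
    obtain ⟨n, hn, hpn⟩ := exists_norm_eq_one_inner_eq_zero (one_lt_rank_euclideanSpace hd) p.2
    rcases le_total 0 (n 0) with h | h
    · exact ⟨n, hn, hpn, h⟩
    · exact ⟨-n, by rwa [norm_neg], by rw [inner_neg_right, hpn, neg_zero], neg_nonneg.2 h⟩
  have hc : 0 < u 0 - sin p.1 := by linarith [sin_neg_of_neg_of_neg_pi_lt hT.2 hT.1]
  have hnorm (s : ℝ) : ‖(greatCircleCurve p u π π s).2‖ = 1 := norm_greatCircle hn hu hpu
  have htime {s : ℝ} (hs : s ∈ Icc (0 : ℝ) 1) : |(greatCircleCurve p u π π s).1| ≤ π :=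
    abs_le.2 ⟨by simp only [greatCircleCurve]; nlinarith [hT.1, hs.1, pi_pos],
      by simp only [greatCircleCurve]; nlinarith [hT.2, hs.2, pi_pos]⟩
  refine ⟨greatCircleCurve p u π π, ?_, 1 / 2, by norm_num, ?_⟩
  · have hend : greatCircleCurve p u π π 1 = refocusPoint p := by
      simp only [greatCircleCurve, refocusPoint, mul_one, greatCircle_pi]
    rw [← hend]
    refine isFutureNullGeodesic_greatCircleCurve hn hu hpu pi_pos fun s hs =>
      mem_compactifiedMinkowski_iff.2 ⟨hnorm s, htime hs, ?_⟩
    rw [conformalFactor_greatCircleCurve hΩ]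
    exact mul_nonneg (sin_nonneg_of_nonneg_of_le_pi (mul_nonneg pi_pos.le hs.1)
      (mul_le_of_le_one_right pi_pos.le hs.2)) hc.le
  · refine mem_physicalSpacetime_iff.2 ⟨hnorm _, htime (by norm_num), ?_⟩
    rwa [conformalFactor_greatCircleCurve hΩ, mul_one_div, sin_pi_div_two, one_mul]

lemma avoids_spatialInfinity_iff_entersPhysical (hp : p ∈ scriMinus d) (hq : q ∈ scriPlus d)
    (hγ : IsFutureNullGeodesic γ p q) :
    (∀ s ∈ Icc (0 : ℝ) 1, γ s ≠ spatialInfinity d) ↔ EntersPhysical γ := by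
  obtain ⟨-, hpT, hpΩ⟩ := mem_scriMinus_iff.1 hp
  obtain ⟨-, hqT, -⟩ := mem_scriPlus_iff.1 hq
  obtain ⟨k, hk, u, hu⟩ := hγ.exists_eq_greatCircleCurve
  constructor
  · intro havoid
    have hqk : p.1 + k = q.1 := by
      rw [← hγ.target, hu 1 (right_mem_Icc.2 zero_le_one), greatCircleCurve, mul_one]
    have hs : -p.1 / k ∈ Icc (0 : ℝ) 1 :=
      ⟨div_nonneg (neg_nonneg.2 hpT.2.le) hk.le, (div_le_one hk).2 (by linarith [hqT.1])⟩
    have hT : (γ (-p.1 / k)).1 = 0 := by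
      rw [hu _ hs, greatCircleCurve, mul_div_cancel₀ _ hk.ne', add_neg_cancel]
    obtain ⟨hn, hπ, hΩ⟩ := mem_compactifiedMinkowski_iff.1 (hγ.mem _ hs)
    refine ⟨_, hs, mem_physicalSpacetime_iff.2 ⟨hn, hπ, hΩ.lt_of_ne' fun h0 => ?_⟩⟩
    exact havoid _ hs (eq_spatialInfinity (hγ.mem _ hs) hT h0)
  · rintro ⟨t, ht, hγt⟩ s hs hγs
    have hΩt := (mem_physicalSpacetime_iff.1 hγt).2.2
    have hT : p.1 + k * s = 0 := congrArg Prod.fst ((hu s hs).symm.trans hγs)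
    have hΩs : conformalFactor (γ s) = 0 := by rw [hγs, conformalFactor_spatialInfinity]
    rw [hu t ht, conformalFactor_greatCircleCurve hpΩ] at hΩt
    rw [hu s hs, conformalFactor_greatCircleCurve hpΩ] at hΩs
    have hsin : 0 < sin (k * s) :=
      sin_pos_of_pos_of_lt_pi (by linarith [hpT.2]) (by linarith [hpT.1])
    exact right_ne_zero_of_mul hΩt.ne' ((mul_eq_zero_iff_left hsin.ne').1 hΩs)

lemma eq_refocusPoint_of_entersPhysical (hp : p ∈ scriMinus d) (hq : q ∈ scriPlus d)
    (hγ : IsFutureNullGeodesic γ p q) (hM : EntersPhysical γ) : q = refocusPoint p := by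
  obtain ⟨-, hpT, hpΩ⟩ := mem_scriMinus_iff.1 hp
  obtain ⟨-, hqT, hqΩ⟩ := mem_scriPlus_iff.1 hq
  obtain ⟨k, hk, u, hu⟩ := hγ.exists_eq_greatCircleCurve
  have hend : q = greatCircleCurve p u k k 1 := by
    rw [← hγ.target, hu 1 (right_mem_Icc.2 zero_le_one)]
  obtain ⟨t, ht, hγt⟩ := hM
  have hΩt := (mem_physicalSpacetime_iff.1 hγt).2.2
  rw [hu t ht, conformalFactor_greatCircleCurve hpΩ] at hΩt
  have hqk : q.1 = p.1 + k := by rw [hend, greatCircleCurve, mul_one]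
  have hk_pi : k = π := by
    rw [hend, conformalFactor_greatCircleCurve hpΩ, mul_one] at hqΩ
    have hsin : sin (k - π) = 0 := by
      rw [sin_sub_pi, (mul_eq_zero_iff_right (right_ne_zero_of_mul hΩt.ne')).1 hqΩ, neg_zero]
    exact sub_eq_zero.1 ((sin_eq_zero_iff_of_lt_of_lt (by linarith)
      (by linarith [hqT.2, hpT.1])).1 hsin)
  rw [hend, hk_pi, greatCircleCurve, mul_one, greatCircle_pi, refocusPoint]

lemma mem_pastGeneratorSegment_of_angle_eq (hd : 1 ≤ d) (hr : r ∈ scriPlus d)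
    (hq : q ∈ scriPlus d) (h : angle r.2 q.2 = q.1 - r.1) : r ∈ pastGeneratorSegment q := by
  obtain ⟨hrn, hrT, hrΩ⟩ := mem_scriPlus_iff.1 hr
  obtain ⟨hqn, hqT, hqΩ⟩ := mem_scriPlus_iff.1 hq
  rcases (angle_nonneg r.2 q.2).eq_or_lt' with h0 | hk
  · exact .inl (Prod.ext (by linarith) (eq_of_angle_eq_zero_of_norm_eq h0 (hrn.trans hqn.symm)))
  obtain ⟨u, hu, hru, hend⟩ := exists_greatCircle_eq (one_lt_rank_euclideanSpace hd) hrn hqn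
  rw [h] at hk hend
  set k := q.1 - r.1 with hk_def
  have hcurve : greatCircleCurve r u k k 1 = q := by
    rw [greatCircleCurve, mul_one, hend, hk_def, add_sub_cancel]
  have hc : u 0 - sin r.1 = 0 := by
    rw [← hcurve, conformalFactor_greatCircleCurve hrΩ, mul_one] at hqΩ
    exact (mul_eq_zero_iff_left
      (sin_pos_of_pos_of_lt_pi hk (by linarith [hqT.2, hrT.1])).ne').1 hqΩ
  have hmem : ∀ s ∈ Icc (0 : ℝ) 1, greatCircleCurve r u k k s ∈ scriPlus d := fun s hs =>
    mem_scriPlus_iff.2 ⟨norm_greatCircle hrn hu hru,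
      ⟨add_pos_of_pos_of_nonneg hrT.1 (mul_nonneg hk.le hs.1),
        by simp only [greatCircleCurve]; nlinarith [hs.2, hqT.2]⟩,
      by rw [conformalFactor_greatCircleCurve hrΩ, hc, mul_zero]⟩
  refine .inr ⟨greatCircleCurve r u k k, ?_, hmem⟩
  rw [← hcurve]
  exact isFutureNullGeodesic_greatCircleCurve hrn hu hru hk fun s hs => scriPlus_subset (hmem s hs)

lemma pastGeneratorSegment_subset (hq : q ∈ scriPlus d) : pastGeneratorSegment q ⊆ scriPlus d := by
  rintro r (rfl | ⟨γ, hγ, hmem⟩)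
  · exact hq
  · exact hγ.source ▸ hmem 0 (left_mem_Icc.2 zero_le_one)

lemma angle_refocusPoint_right : angle r.2 (refocusPoint p).2 = π - angle p.2 r.2 := by
  rw [refocusPoint, angle_neg_right, angle_comm]

lemma tfae_mem_pastGeneratorSegment_refocusPoint (hd : 1 ≤ d) (hp : p ∈ scriMinus d)
    (hr : r ∈ scriPlus d) :
    [r.1 - p.1 ≤ angle p.2 r.2,
      r ∈ pastGeneratorSegment (refocusPoint p),
      r = refocusPoint p ∨ ∃ γ, IsFutureNullGeodesic γ r (refocusPoint p),
      r ∈ causalPast (refocusPoint p)].TFAE := by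
  have hT : (refocusPoint p).1 = p.1 + π := rfl
  tfae_have 1 → 2 := fun h => by
    refine mem_pastGeneratorSegment_of_angle_eq hd hr (refocusPoint_mem_scriPlus hp) ?_
    rw [angle_refocusPoint_right]
    linarith [angle_le_of_mem_scri hp hr]
  tfae_have 2 → 3 := Or.imp_right fun ⟨γ, hγ, _⟩ => ⟨γ, hγ⟩
  tfae_have 3 → 4
    | .inl h => ⟨scriPlus_subset hr, scriPlus_subset (refocusPoint_mem_scriPlus hp), .inl h.symm⟩
    | .inr ⟨_, hγ⟩ => ⟨scriPlus_subset hr, hγ.mem_causalFuture⟩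
  tfae_have 4 → 1 := fun h => by
    have hle := angle_le_of_mem_causalFuture hr.1 h.2
    rw [angle_refocusPoint_right] at hle
    linarith
  tfae_finish

lemma refocusPoint_mem_boundary_causalFuture (hd : 1 ≤ d) (hp : p ∈ scriMinus d) :
    refocusPoint p ∈ boundaryInCompactified (causalFuture p) := by
  have hscri := refocusPoint_mem_scriPlus hp
  have hq := mem_compactifiedMinkowski_iff_abs_le_angle.1 (scriPlus_subset hscri)
  have hqT := (mem_scriPlus_iff.1 hscri).2.1.1
  obtain ⟨γ, hγ, -⟩ := exists_isFutureNullGeodesic_refocusPoint hd hp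
  refine ⟨⟨_, scriPlus_subset hscri⟩, ?_, rfl⟩
  rw [frontier_eq_closure_inter_closure]
  refine ⟨subset_closure hγ.mem_causalFuture, closure_subtype.2 ?_⟩
  -- Earlier events at the antipode of `p` are not causally related to `p`.
  refine map_mem_closure (f := fun t => (t, (refocusPoint p).2)) (s := Ico 0 (refocusPoint p).1)
    (by fun_prop) (by rw [closure_Ico hqT.ne]; exact right_mem_Icc.2 hqT.le) fun t ht => ?_
  have hmem : (t, (refocusPoint p).2) ∈ compactifiedMinkowski d :=
    mem_compactifiedMinkowski_iff_abs_le_angle.2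
      ⟨hq.1, (abs_le_abs_of_nonneg ht.1 ht.2.le).trans hq.2⟩
  refine ⟨⟨_, hmem⟩, fun h => ht.2.not_ge ?_, rfl⟩
  have hle := angle_le_of_mem_causalFuture hp.1 h
  rw [angle_refocusPoint_right, angle_self (norm_ne_zero_iff.1 (hp.1.trans_ne one_ne_zero))] at hle
  simp only [refocusPoint]
  linarith

end Scri

theorem proposition3p3 (d : ℕ) (hd : 1 ≤ d) (p : Ambient d) (hp : p ∈ scriMinus d) :
    (∃! q : Ambient d, q ∈ scriPlus d ∧
      ∃ γ : ℝ → Ambient d, IsFutureNullGeodesic γ p q ∧ EntersPhysical γ) ∧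
    (∀ q ∈ scriPlus d, ∀ γ : ℝ → Ambient d, IsFutureNullGeodesic γ p q →
      ((∀ s ∈ Set.Icc (0 : ℝ) 1, γ s ≠ spatialInfinity d) ↔ EntersPhysical γ)) ∧
    ∀ q ∈ scriPlus d,
      (∃ γ : ℝ → Ambient d, IsFutureNullGeodesic γ p q ∧ EntersPhysical γ) →
        q ∈ boundaryInCompactified (causalFuture p) ∧
        chronologicalFuture p ∩ scriPlus d = scriPlus d \ (causalPast q ∩ scriPlus d) ∧
        {r | r ∈ scriPlus d ∧ ¬ TimelikeConnected p r} =
          {r | r ∈ scriPlus d ∧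
            (r = q ∨ ∃ γ : ℝ → Ambient d, IsFutureNullGeodesic γ r q)} ∧
        {r | r ∈ scriPlus d ∧ ¬ TimelikeConnected p r} = pastGeneratorSegment q := by
  have hdich {r : Ambient d} (hr : r ∈ scriPlus d) :=
    tfae_mem_pastGeneratorSegment_refocusPoint hd hp hr
  have hconn {r : Ambient d} (hr : r ∈ scriPlus d) :
      ¬TimelikeConnected p r ↔ r.1 - p.1 ≤ angle p.2 r.2 := by
    rw [timelikeConnected_iff hd (scriMinus_subset hp) (scriPlus_subset hr)
      ((mem_scriMinus_iff.1 hp).2.1.2.trans (mem_scriPlus_iff.1 hr).2.1.1), not_lt]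
  refine ⟨⟨refocusPoint p, ⟨refocusPoint_mem_scriPlus hp,
      exists_isFutureNullGeodesic_refocusPoint hd hp⟩,
      fun q ⟨hq, γ, hγ, hM⟩ => eq_refocusPoint_of_entersPhysical hp hq hγ hM⟩,
    fun q hq γ hγ => avoids_spatialInfinity_iff_entersPhysical hp hq hγ, ?_⟩
  rintro q hq ⟨γ, hγ, hM⟩
  obtain rfl := eq_refocusPoint_of_entersPhysical hp hq hγ hM
  refine ⟨refocusPoint_mem_boundary_causalFuture hd hp, ?_, ?_, ?_⟩
  · ext r
    rw [sdiff_inter_self_eq_sdiff, Set.mem_sdiff, inter_comm, mem_inter_iff]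
    refine and_congr_right fun hr => ?_
    rw [mem_chronologicalFuture_iff hd (scriMinus_subset hp) (scriPlus_subset hr), ← not_le]
    exact not_congr ((hdich hr).out 0 3)
  · exact ext fun r => and_congr_right fun hr => (hconn hr).trans ((hdich hr).out 0 2)
  · ext r
    exact (and_congr_right fun hr => (hconn hr).trans ((hdich hr).out 0 1)).trans
      (and_iff_right_of_imp (pastGeneratorSegment_subset hq ·))
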